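/- Let $X$ be a real Hilbert space, let $\mu\ge\omega\ge 0$ and $\beta>0$. Let $f\colon X\to\mathbb R$ be $\mu$-strongly convex (that is, $f((1-\tau)x+\tau y)\le(1-\tau)f(x)+\tau f(y)-\tfrac{\mu}{2}\tau(1-\tau)\|x-y\|^2$ for all $x,y\in X$ and $\tau\in\left]0,1\right[$; convex if $\mu=0$) and Fréchet differentiable with a $\beta$-Lipschitz continuous gradient, and let $g\colon X\to\left]-\infty,+\infty\right]$ be proper, lower semicontinuous and $\omega$-hypoconvex, i.e. $$g((1-\tau)x+\tau y)\le(1-\tau)g(x)+\tau g(y)+\tfrac{\omega}{2}\tau(1-\tau)\|x-y\|^2\qquad\text{for all }x,y\in X,\ \tau\in\left]0,1\right[.$$ Suppose that $\operatorname{argmin}(f+g)\neq\varnothing$, let $\gamma\in\left]0,2/(\beta+2\mu)\right[$, and set $\delta=(1-\gamma\mu)/(1-\gamma\omega)$. Then, for every $x\in X$, the set $\operatorname{prox}_{\gamma g}(x)=\operatorname{argmin}_{y\in X}\big(g(y)+\tfrac{1}{2\gamma}\|x-y\|^2\big)$ is a singleton. Regarding $\operatorname{prox}_{\gamma g}$ as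 a map $X\to X$, set $T=\operatorname{prox}_{\gamma g}\circ(\mathrm{Id}-\gamma\nabla f)$. Then $$\operatorname{Fix}T=\{x\in X : 0\in\nabla f(x)+\partial^{\#}g(x)\}=\operatorname{argmin}(f+g)$$ for every abstract subdifferential $\partial^{\#}$. Here an abstract subdifferential assigns to a function $h\colon X\to\left]-\infty,+\infty\right]$ and a point $x\in X$ a set $\partial^{\#}h(x)\subseteq X$, such that, for proper lower semicontinuous $h$: $\partial^{\#}h$ is the subdifferential of convex analysis if $h$ is convex; $\partial^{\#}h(x)=\{\nabla h(x)\}$ for all $x$ if $h$ is continuously differentiable; $0\in\partial^{\#}h(x)$ if $h$ has a local minimum at $x$ with $h(x)<+\infty$; and $\partial^{\#}\big(h+\tfrac b2\|\cdot-z\|^2\big)(x)=\partial^{\#}h(x)+b(x-z)$ for all $b\in\mathbb R$ and $x,z\in X$. (The Fréchet subdifferential is an example.) Moreover, for every $x_0\in X$: (i) There exists $\overline x\in\operatorname{Fix}T$ such that $T^nx_0$ converges weakly to $\overline x$. (ii) If $\mu>\omega$, then, additionally, $\operatorname{Fix}T=\operatorname{argmin}(f+g)=\{\overline x\}$, $\delta\in\left]0,1\right[$,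 and $T^nx_0$ converges strongly to $\overline x$ with linear rate $\delta$: for all $n\in\mathbb N$, $\|T^{n+1}x_0-\overline x\|\le\delta\|T^nx_0-\overline x\|$, and hence $\|T^nx_0-\overline x\|\le\delta^n\|x_0-\overline x\|$. -/

import Mathlib

open Set Filter Topology
open scoped Pointwise Gradient RealInnerProductSpace

namespace ForwardBackward

variable {X : Type*} [NormedAddCommGroup X] [InnerProductSpace ℝ X]

/-- A function `X → ]-∞, +∞]` is proper: it never takes the value `-∞`, and it is
finite somewhere. -/
def IsProper (g : X → EReal) : Prop :=
  (∀ x, g x ≠ ⊥) ∧ ∃ x, g x ≠ ⊤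

/-- `lam`-hypoconvexity of an extended-real-valued function. For `lam = 0` this is convexity. -/
def IsHypoconvex (lam : ℝ) (g : X → EReal) : Prop :=
  ∀ x y : X, ∀ τ : ℝ, 0 < τ → τ < 1 →
    g ((1 - τ) • x + τ • y) ≤
      ((1 - τ : ℝ) : EReal) * g x + ((τ : ℝ) : EReal) * g y
        + ((lam / 2 * (τ * (1 - τ)) * ‖x - y‖ ^ 2 : ℝ) : EReal)

/-- The set of global minimizers. -/
def argmin (h : X → EReal) : Set X :=
  {x | ∀ y, h x ≤ h y}

/-- The (set-valued) proximal mapping `prox_{γ g}`: the minimizers of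
`y ↦ g y + ‖x - y‖² / (2 γ)`. -/
def prox (γ : ℝ) (g : X → EReal) (x : X) : Set X :=
  argmin fun y => g y + ((1 / (2 * γ) * ‖x - y‖ ^ 2 : ℝ) : EReal)

/-- The zeros of a set-valued operator. -/
def zer (A : X → Set X) : Set X :=
  {x | 0 ∈ A x}

/-- The subdifferential of convex analysis. -/
def convexSubdifferential (f : X → EReal) (x : X) : Set X :=
  {u | ∀ y, f x + ((⟪u, y - x⟫ : ℝ) : EReal) ≤ f y}

/-- The Fréchet subdifferential. -/
def frechetSubdifferential (f : X → EReal) (x : X) : Set X :=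
  {u | f x ≠ ⊤ ∧ ∀ ε : ℝ, 0 < ε →
    ∀ᶠ y in 𝓝 x, f x + ((⟪u, y - x⟫ - ε * ‖y - x‖ : ℝ) : EReal) ≤ f y}

/-- An abstract subdifferential on the proper lower semicontinuous functions on `X`.
Its values at other functions are irrelevant. -/
structure AbstractSubdifferential (X : Type*) [NormedAddCommGroup X] [InnerProductSpace ℝ X]
    [CompleteSpace X] where
  /-- the set of abstract subgradients of a function at a point -/
  subdiff : (X → EReal) → X → Set X
  eq_convex : ∀ f : X → EReal, IsProper f → LowerSemicontinuous f → IsHypoconvex 0 f →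
    ∀ x, subdiff f x = convexSubdifferential f x
  eq_gradient : ∀ φ : X → ℝ, ContDiff ℝ 1 φ →
    ∀ x, subdiff (fun y => (φ y : EReal)) x = {∇ φ x}
  zero_mem : ∀ f : X → EReal, IsProper f → LowerSemicontinuous f →
    ∀ x, f x ≠ ⊤ → IsLocalMin f x → 0 ∈ subdiff f x
  add_quadratic : ∀ f : X → EReal, IsProper f → LowerSemicontinuous f →
    ∀ (b : ℝ) (z x : X),
      subdiff (fun y => f y + ((b * (‖y - z‖ ^ 2 / 2) : ℝ) : EReal)) x =
        subdiff f x + {b • (x - z)}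

theorem frechetSubdifferential_add [CompleteSpace X] {f : X → EReal} {φ : X → ℝ} {x u w : X}
    (hu : u ∈ frechetSubdifferential f x) (hφ : HasGradientAt φ w x) :
    u + w ∈ frechetSubdifferential (fun y => f y + (φ y : EReal)) x := by
  refine ⟨EReal.add_ne_top hu.1 (EReal.coe_ne_top _), fun ε hε => ?_⟩
  have h1 := hu.2 (ε / 2) (by positivity)
  have h2 := (hasGradientAt_iff_isLittleO.1 hφ).def (c := ε / 2) (by positivity)
  filter_upwards [h1, h2] with y h1 h2
  rw [Real.norm_eq_abs, abs_le] at h2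
  have h3 : φ x + (⟪w, y - x⟫ - ε / 2 * ‖y - x‖) ≤ φ y := by linarith [h2.1]
  have h4 := add_le_add h1 (EReal.coe_le_coe_iff.2 h3)
  refine le_trans (le_of_eq ?_) h4
  rw [inner_add_left, add_assoc, add_assoc, ← EReal.coe_add, ← EReal.coe_add]
  congr 2
  ring

theorem hasGradientAt_neg [CompleteSpace X] {φ : X → ℝ} {x w : X} (h : HasGradientAt φ w x) :
    HasGradientAt (fun y => -φ y) (-w) x := by
  rw [hasGradientAt_iff_hasFDerivAt] at h ⊢
  rw [map_neg]
  exact h.fun_neg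

theorem frechetSubdifferential_zero {u x : X}
    (hu : u ∈ frechetSubdifferential (fun _ : X => (0 : EReal)) x) : u = 0 := by
  by_contra hne
  have hpos : 0 < ‖u‖ := norm_pos_iff.2 hne
  have h := hu.2 (‖u‖ / 2) (by positivity)
  have ht : Tendsto (fun t : ℝ => x + t • u) (𝓝[>] 0) (𝓝 x) := by
    have : ContinuousAt (fun t : ℝ => x + t • u) 0 := by fun_prop
    simpa [ContinuousAt] using this.mono_left nhdsWithin_le_nhds
  obtain ⟨t, h1, h2⟩ := ((ht.eventually h).and self_mem_nhdsWithin).exists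
  have h2 : 0 < t := h2
  simp only [add_sub_cancel_left, zero_add, inner_smul_right, real_inner_self_eq_norm_sq,
    norm_smul, Real.norm_eq_abs, abs_of_pos h2] at h1
  have h3 : t * ‖u‖ ^ 2 - ‖u‖ / 2 * (t * ‖u‖) ≤ 0 := by exact_mod_cast h1
  have : 0 < t * ‖u‖ ^ 2 := by positivity
  nlinarith

theorem frechetSubdifferential_eq_convex {f : X → EReal} (hp : IsProper f)
    (hc : IsHypoconvex 0 f) (x : X) :
    frechetSubdifferential f x = convexSubdifferential f x := by
  ext u
  constructor
  · rintro ⟨hx, hu⟩ y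
    by_cases hy : f y = ⊤
    · rw [hy]; exact le_top
    obtain ⟨a, ha⟩ : ∃ a : ℝ, (a : EReal) = f x := ⟨_, EReal.coe_toReal hx (hp.1 x)⟩
    obtain ⟨b, hb⟩ : ∃ b : ℝ, (b : EReal) = f y := ⟨_, EReal.coe_toReal hy (hp.1 y)⟩
    rw [← ha, ← hb, ← EReal.coe_add, EReal.coe_le_coe_iff]
    have key : ∀ ε : ℝ, 0 < ε → a + (⟪u, y - x⟫ - ε * ‖y - x‖) ≤ b := by
      intro ε hε
      have ht : Tendsto (fun t : ℝ => (1 - t) • x + t • y) (𝓝[>] 0) (𝓝 x) := by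
        have : ContinuousAt (fun t : ℝ => (1 - t) • x + t • y) 0 := by fun_prop
        simpa [ContinuousAt] using this.mono_left nhdsWithin_le_nhds
      have h01 : ∀ᶠ t : ℝ in 𝓝[>] 0, t ∈ Ioo (0 : ℝ) 1 := Ioo_mem_nhdsGT one_pos
      obtain ⟨t, h1, h2⟩ := ((ht.eventually (hu ε hε)).and h01).exists
      have h3 := h1.trans (hc x y t h2.1 h2.2)
      have e : (1 - t) • x + t • y - x = t • (y - x) := by module
      rw [e, ← ha, ← hb, inner_smul_right, norm_smul, Real.norm_eq_abs, abs_of_pos h2.1] at h3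
      have h4 : a + (t * ⟪u, y - x⟫ - ε * (t * ‖y - x‖)) ≤
          (1 - t) * a + t * b + 0 / 2 * (t * (1 - t)) * ‖x - y‖ ^ 2 := by exact_mod_cast h3
      have h5 : t * (a + (⟪u, y - x⟫ - ε * ‖y - x‖)) ≤ t * b := by linarith
      exact le_of_mul_le_mul_left h5 h2.1
    have hlim : Tendsto (fun ε : ℝ => a + (⟪u, y - x⟫ - ε * ‖y - x‖)) (𝓝[>] 0)
        (𝓝 (a + ⟪u, y - x⟫)) := by
      have : ContinuousAt (fun ε : ℝ => a + (⟪u, y - x⟫ - ε * ‖y - x‖)) 0 := by fun_prop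
      simpa [ContinuousAt] using this.mono_left nhdsWithin_le_nhds
    exact le_of_tendsto hlim (by filter_upwards [self_mem_nhdsWithin] with ε hε using key ε hε)
  · intro hu
    refine ⟨fun hx => ?_, fun ε hε => Eventually.of_forall fun y => ?_⟩
    · obtain ⟨y, hy⟩ := hp.2
      have := hu y
      rw [hx, EReal.top_add_coe, top_le_iff] at this
      exact hy this
    · refine le_trans (add_le_add le_rfl (EReal.coe_le_coe_iff.2 ?_)) (hu y)
      have : 0 ≤ ε * ‖y - x‖ := by positivity
      linarith

/-- The Fréchet subdifferential is an abstract subdifferential. -/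
def frechet (X : Type*) [NormedAddCommGroup X] [InnerProductSpace ℝ X] [CompleteSpace X] :
    AbstractSubdifferential X where
  subdiff := frechetSubdifferential
  eq_convex _ hp _ hc x := frechetSubdifferential_eq_convex hp hc x
  eq_gradient φ hφ x := by
    have hg : HasGradientAt φ (∇ φ x) x := (hφ.differentiable one_ne_zero x).hasGradientAt
    ext u
    rw [mem_singleton_iff]
    constructor
    · intro hu
      have h := frechetSubdifferential_add hu (hasGradientAt_neg hg)
      have e : (fun y => (φ y : EReal) + ((-φ y : ℝ) : EReal)) = fun _ => (0 : EReal) := by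
        funext y
        rw [← EReal.coe_add, add_neg_cancel, EReal.coe_zero]
      have h' : u + -∇ φ x ∈ frechetSubdifferential (fun _ : X => (0 : EReal)) x := by
        rw [← e]; exact h
      have := frechetSubdifferential_zero h'
      rwa [← sub_eq_add_neg, sub_eq_zero] at this
    · rintro rfl
      have h0 : (0 : X) ∈ frechetSubdifferential (fun _ : X => (0 : EReal)) x := by
        refine ⟨EReal.zero_ne_top, fun ε hε => Eventually.of_forall fun y => ?_⟩
        rw [inner_zero_left, zero_add, zero_sub, ← EReal.coe_zero, EReal.coe_le_coe_iff]
        have : 0 ≤ ε * ‖y - x‖ := by positivity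
        linarith
      simpa using frechetSubdifferential_add h0 hg
  zero_mem f _ _ x hx hmin := by
    refine ⟨hx, fun ε hε => ?_⟩
    filter_upwards [hmin] with y hy
    refine le_trans (add_le_add le_rfl (EReal.coe_le_coe_iff.2 (?_ : _ ≤ (0 : ℝ)))) ?_
    · have : 0 ≤ ε * ‖y - x‖ := by positivity
      rw [inner_zero_left]; linarith
    · simpa using hy
  add_quadratic f _ _ b z x := by
    have hq : HasGradientAt (fun y : X => b * (‖y - z‖ ^ 2 / 2)) (b • (x - z)) x := by
      rw [hasGradientAt_iff_hasFDerivAt]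
      have h1 : HasFDerivAt (fun y : X => y - z) (ContinuousLinearMap.id ℝ X) x :=
        (hasFDerivAt_id x).sub_const z
      have h2 := (h1.norm_sq.mul_const (1 / 2 : ℝ)).const_mul b
      have e1 : (fun y : X => b * (‖y - z‖ ^ 2 / 2)) =
          fun y : X => b * (‖y - z‖ ^ 2 * (1 / 2)) := by
        funext y; ring
      rw [e1]
      refine h2.congr_fderiv ?_
      ext v
      simp
    ext u
    rw [add_singleton, image_add_right, mem_preimage]
    constructor
    · intro hu
      have h := frechetSubdifferential_add hu (hasGradientAt_neg hq)
      have e : (fun y => f y + ((b * (‖y - z‖ ^ 2 / 2) : ℝ) : EReal)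
          + ((-(b * (‖y - z‖ ^ 2 / 2)) : ℝ) : EReal)) = f := by
        funext y
        rw [add_assoc, ← EReal.coe_add, add_neg_cancel, EReal.coe_zero, add_zero]
      rw [e] at h
      exact h
    · intro hu
      simpa using frechetSubdifferential_add hu hq

end ForwardBackward

/-! Both fixed points of `T` and minimizers of `f + g` are characterized by the same condition: `-∇f
p` is a subgradient of `g` at `p` up to the error `ω/2 ‖· - p‖²` (`IsHypoSubgradient`). For
minimizers of `f + g` the `μ`-strong convexity of `f` absorbs this error since `ω ≤ μ`; for the prox
the quadratic `‖x - ·‖²/(2γ)` does, since `γω < 1`. Every abstract subdifferential agrees with this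
notion on `g`, because `g + ω/2 ‖·‖²` is convex (`mem_subdiff_iff`).

For convergence, split `∇f = (∇f - μ Id) + μ Id`. The first summand is cocoercive
(`cocoercive_gradient`), so the forward step is `(1 - γμ)`-Lipschitz with a surplus term; the prox
satisfies a monotonicity estimate with constant `1 - γω` (`mul_norm_sq_le_inner_of_mem_prox`).
Together they make `T` `δ`-Lipschitz (`norm_backward_le`), which gives the linear rate when `ω < μ`,
and averaged even when `μ = ω` (`norm_sq_sub_le`). Weak convergence is then the classical argument:
asymptotic regularity, demiclosedness, and Opial's uniqueness of weak cluster points. -/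

namespace ForwardBackward

variable {X : Type*} [NormedAddCommGroup X] [InnerProductSpace ℝ X]

/-! ### Averaged operators -/

section Averaged

variable {T : X → X} {K : ℝ}

/-- A form of averagedness: `T` is averaged iff this holds for some `K > 0`. -/
def IsAveraged (K : ℝ) (T : X → X) : Prop :=
  ∀ x y, ‖(x - y) - (T x - T y)‖ ^ 2 ≤ K * (‖x - y‖ ^ 2 - ‖T x - T y‖ ^ 2)

theorem IsAveraged.nonexpansive (hT : IsAveraged K T) (hK : 0 < K) (x y : X) :
    ‖T x - T y‖ ≤ ‖x - y‖ := by
  have h : 0 ≤ ‖x - y‖ ^ 2 - ‖T x - T y‖ ^ 2 :=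
    nonneg_of_mul_nonneg_right ((sq_nonneg _).trans (hT x y)) hK
  exact (sq_le_sq₀ (norm_nonneg _) (norm_nonneg _)).1 (by linarith)

/-- Distances of the iterates of an averaged operator to a fixed point converge. -/
theorem IsAveraged.tendsto_norm_iterate_sub (hT : IsAveraged K T) (hK : 0 < K) {z : X}
    (hz : T z = z) (x : X) : ∃ l, Tendsto (fun n : ℕ => ‖T^[n] x - z‖) atTop (𝓝 l) := by
  refine ⟨_, tendsto_atTop_ciInf (antitone_nat_of_succ_le fun n => ?_)
    ⟨0, by rintro _ ⟨n, rfl⟩; exact norm_nonneg _⟩⟩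
  rw [Function.iterate_succ_apply']
  simpa [hz] using hT.nonexpansive hK (T^[n] x) z

/-- Asymptotic regularity. -/
theorem IsAveraged.tendsto_sub_iterate (hT : IsAveraged K T) (hK : 0 < K) {z : X}
    (hz : T z = z) (x : X) :
    Tendsto (fun n : ℕ => T^[n] x - T (T^[n] x)) atTop (𝓝 0) := by
  obtain ⟨l, hl⟩ := hT.tendsto_norm_iterate_sub hK hz x
  have h1 : Tendsto (fun n : ℕ => K * (‖T^[n] x - z‖ ^ 2 - ‖T^[n + 1] x - z‖ ^ 2)) atTop
      (𝓝 (K * (l ^ 2 - l ^ 2))) :=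
    ((hl.pow 2).sub (((tendsto_add_atTop_iff_nat 1).2 hl).pow 2)).const_mul K
  rw [sub_self, mul_zero] at h1
  have h2 : Tendsto (fun n : ℕ => ‖T^[n] x - T (T^[n] x)‖ ^ 2) atTop (𝓝 0) := by
    refine squeeze_zero (fun n => sq_nonneg _) (fun n => ?_) h1
    have h := hT (T^[n] x) z
    rw [hz] at h
    rw [Function.iterate_succ_apply']
    rwa [sub_sub_sub_cancel_right] at h
  rw [tendsto_zero_iff_norm_tendsto_zero]
  have h3 := h2.sqrt
  simpa using h3

/-- Demiclosedness principle for nonexpansive maps, along an arbitrary filter. -/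
theorem eq_of_tendsto_inner_of_nonexpansive {ι : Type*} {F : Filter ι} [F.NeBot]
    (hT : ∀ x y, ‖T x - T y‖ ≤ ‖x - y‖) {u : ι → X} {w : X} {R : ℝ}
    (hR : ∀ i, ‖u i - w‖ ≤ R) (hw : ∀ v, Tendsto (fun i => ⟪u i, v⟫) F (𝓝 ⟪w, v⟫))
    (hu : Tendsto (fun i => u i - T (u i)) F (𝓝 0)) : T w = w := by
  have h0 : Tendsto (fun i => ‖u i - T (u i)‖) F (𝓝 0) := by simpa using hu.norm
  have hi : Tendsto (fun i => ⟪u i - w, w - T w⟫) F (𝓝 0) := by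
    simpa [inner_sub_left] using (hw (w - T w)).sub_const ⟪w, w - T w⟫
  -- With `r = ‖u i - T (u i)‖`, this upper bound for `‖w - T w‖²` comes from expanding `‖u i - T
  -- w‖²` around `w` and using `‖u i - T w‖ ≤ r + ‖u i - w‖`; the terms `‖u i - w‖²` cancel.
  have hlim : Tendsto (fun i => ‖u i - T (u i)‖ ^ 2 + 2 * (R * ‖u i - T (u i)‖)
      - 2 * ⟪u i - w, w - T w⟫) F (𝓝 0) := by
    simpa using ((h0.pow 2).add ((h0.const_mul R).const_mul 2)).sub (hi.const_mul 2)
  have hle : ‖w - T w‖ ^ 2 ≤ 0 := by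
    refine ge_of_tendsto hlim (Eventually.of_forall fun i => ?_)
    have e : u i - T w = (u i - w) + (w - T w) := by abel
    have h1 : ‖u i - T w‖ ^ 2 = ‖u i - w‖ ^ 2 + 2 * ⟪u i - w, w - T w⟫ + ‖w - T w‖ ^ 2 := by
      rw [e, norm_add_sq_real]
    have h2 : ‖u i - T w‖ ≤ ‖u i - T (u i)‖ + ‖u i - w‖ := by
      have := norm_sub_le_norm_sub_add_norm_sub (u i) (T (u i)) (T w)
      linarith [hT (u i) w]
    have h3 : ‖u i - T w‖ ^ 2 ≤ (‖u i - T (u i)‖ + ‖u i - w‖) ^ 2 :=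
      pow_le_pow_left₀ (norm_nonneg _) h2 2
    have h4 := mul_le_mul_of_nonneg_right (hR i) (norm_nonneg (u i - T (u i)))
    nlinarith
  have h0 : ‖w - T w‖ = 0 := pow_eq_zero_iff two_ne_zero |>.1 (le_antisymm hle (sq_nonneg _))
  rw [norm_eq_zero, sub_eq_zero] at h0
  exact h0.symm

/-- Bounded families in a Hilbert space converge weakly along every ultrafilter. -/
theorem exists_tendsto_inner_of_bounded [CompleteSpace X] {ι : Type*} (U : Ultrafilter ι)
    {u : ι → X} {R : ℝ} (hR : ∀ i, ‖u i‖ ≤ R) :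
    ∃ w, ∀ v, Tendsto (fun i => ⟪u i, v⟫) U (𝓝 ⟪w, v⟫) := by
  -- For fixed `v` the values lie in a compact interval, so they converge along `U`; the limit is a
  -- bounded linear functional of `v`, represented by Riesz.
  have h : ∀ v, ∃ l, Tendsto (fun i => ⟪u i, v⟫) U (𝓝 l) := fun v => by
    have hc : IsCompact (Icc (-(R * ‖v‖)) (R * ‖v‖)) := isCompact_Icc
    obtain ⟨l, -, hl⟩ := hc.ultrafilter_le_nhds (U.map fun i => ⟪u i, v⟫) (by
      rw [le_principal_iff]
      refine Eventually.of_forall (f := (U : Filter ι)) fun i => abs_le.1 ?_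
      exact (abs_real_inner_le_norm _ _).trans
        (mul_le_mul_of_nonneg_right (hR i) (norm_nonneg _)))
    exact ⟨l, hl⟩
  choose L hL using h
  let A : X →ₗ[ℝ] ℝ :=
    { toFun := L
      map_add' := fun v w => tendsto_nhds_unique (hL (v + w)) (by
        simpa only [inner_add_right] using (hL v).add (hL w))
      map_smul' := fun c v => tendsto_nhds_unique (hL (c • v)) (by
        simpa only [inner_smul_right, RingHom.id_apply, smul_eq_mul] using (hL v).const_mul c) }
  let B : X →L[ℝ] ℝ := A.mkContinuous R fun v =>
    le_of_tendsto (hL v).norm (Eventually.of_forall fun i =>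
      (abs_real_inner_le_norm _ _).trans (mul_le_mul_of_nonneg_right (hR i) (norm_nonneg _)))
  refine ⟨(InnerProductSpace.toDual ℝ X).symm B, fun v => ?_⟩
  rw [InnerProductSpace.toDual_symm_apply]
  exact hL v

/-- Iterates of an averaged operator with a fixed point converge weakly to a fixed point. -/
theorem IsAveraged.exists_tendsto_weakly [CompleteSpace X] (hT : IsAveraged K T) (hK : 0 < K)
    {z : X} (hz : T z = z) (x : X) :
    ∃ w, T w = w ∧
      Tendsto (fun n : ℕ => toWeakSpace ℝ X (T^[n] x)) atTop (𝓝 (toWeakSpace ℝ X w)) := by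
  have hbound : ∀ n : ℕ, ‖T^[n] x‖ ≤ ‖x - z‖ + ‖z‖ := fun n => by
    have h : ‖T^[n] x - z‖ ≤ ‖x - z‖ := by
      induction n with
      | zero => rfl
      | succ n ih =>
        rw [Function.iterate_succ_apply']
        have := hT.nonexpansive hK (T^[n] x) z
        rw [hz] at this
        exact this.trans ih
    linarith [norm_le_norm_sub_add (T^[n] x) z]
  have hlim : ∀ U : Ultrafilter ℕ, (U : Filter ℕ) ≤ atTop → ∃ w, T w = w ∧
      ∀ v, Tendsto (fun n : ℕ => ⟪T^[n] x, v⟫) U (𝓝 ⟪w, v⟫) := fun U hU => by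
    obtain ⟨w, hw⟩ := exists_tendsto_inner_of_bounded U hbound
    refine ⟨w, eq_of_tendsto_inner_of_nonexpansive (F := (U : Filter ℕ))
      (hT.nonexpansive hK) (R := ‖x - z‖ + ‖z‖ + ‖w‖) (fun n => ?_) hw
      ((hT.tendsto_sub_iterate hK hz x).mono_left hU), hw⟩
    exact (norm_sub_le _ _).trans (by gcongr; exact hbound n)
  -- Opial: the distances to both fixed points converge, so by polarization `⟪T^[n] x, w₁ - w₂⟫`
  -- converges along all of `atTop`, forcing `⟪w₁, w₁ - w₂⟫ = ⟪w₂, w₁ - w₂⟫`.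
  have huniq : ∀ U V : Ultrafilter ℕ, (U : Filter ℕ) ≤ atTop → (V : Filter ℕ) ≤ atTop →
      ∀ w₁ w₂, T w₁ = w₁ → T w₂ = w₂ →
      (∀ v, Tendsto (fun n : ℕ => ⟪T^[n] x, v⟫) U (𝓝 ⟪w₁, v⟫)) →
      (∀ v, Tendsto (fun n : ℕ => ⟪T^[n] x, v⟫) V (𝓝 ⟪w₂, v⟫)) → w₁ = w₂ := by
    intro U V hU hV w₁ w₂ h₁ h₂ hw₁ hw₂
    obtain ⟨l₁, hl₁⟩ := hT.tendsto_norm_iterate_sub hK h₁ x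
    obtain ⟨l₂, hl₂⟩ := hT.tendsto_norm_iterate_sub hK h₂ x
    have hl : Tendsto (fun n : ℕ => ⟪T^[n] x, w₁ - w₂⟫) atTop
        (𝓝 ((l₂ ^ 2 - l₁ ^ 2 + ‖w₁‖ ^ 2 - ‖w₂‖ ^ 2) / 2)) := by
      refine ((((hl₂.pow 2).sub (hl₁.pow 2)).add_const (‖w₁‖ ^ 2)).sub_const
        (‖w₂‖ ^ 2)).div_const 2 |>.congr fun n => ?_
      rw [norm_sub_sq_real, norm_sub_sq_real, inner_sub_right]
      ring
    have e₁ := tendsto_nhds_unique (hw₁ (w₁ - w₂)) (hl.mono_left hU)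
    have e₂ := tendsto_nhds_unique (hw₂ (w₁ - w₂)) (hl.mono_left hV)
    have e : ⟪w₁ - w₂, w₁ - w₂⟫ = 0 := by rw [inner_sub_left, e₁, e₂, sub_self]
    exact sub_eq_zero.1 (inner_self_eq_zero.1 e)
  have hof : ((Ultrafilter.of atTop : Ultrafilter ℕ) : Filter ℕ) ≤ atTop := Ultrafilter.of_le _
  obtain ⟨w, hw, hwl⟩ := hlim _ hof
  refine ⟨w, hw, ?_⟩
  -- The first goal is that functionals separate points; the second is convergence under each
  -- functional, tested on ultrafilters.
  refine (WeakBilin.tendsto_iff_forall_eval_tendsto (topDualPairing ℝ X).flip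
    fun a b h => ?_).2 fun φ => ?_
  · refine ext_inner_right (𝕜 := ℝ) (E := X) fun v => ?_
    have h : (innerSL ℝ v) (show X from a) = innerSL ℝ v (show X from b) :=
      LinearMap.congr_fun h (innerSL ℝ v)
    simpa [real_inner_comm] using h
  · rw [tendsto_iff_ultrafilter]
    intro U hU
    obtain ⟨w', hw', hwl'⟩ := hlim U hU
    obtain rfl := huniq _ _ hof hU w w' hw hw' hwl hwl'
    have := hwl' ((InnerProductSpace.toDual ℝ X).symm φ)
    have e : ∀ y, φ y = ⟪y, (InnerProductSpace.toDual ℝ X).symm φ⟫ := fun y => by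
      rw [real_inner_comm, InnerProductSpace.toDual_symm_apply]
    change Tendsto (fun n : ℕ => φ (T^[n] x)) U (𝓝 (φ w))
    simpa only [e] using this

end Averaged

end ForwardBackward

namespace ForwardBackward

variable {X : Type*} [NormedAddCommGroup X] [InnerProductSpace ℝ X]

/-! ### Smooth strongly convex functions -/

section Smooth

variable [CompleteSpace X]

theorem hasDerivAt_line {φ : X → ℝ} {u p d : X} {t : ℝ} (h : HasGradientAt φ u (p + t • d)) :
    HasDerivAt (fun s : ℝ => φ (p + s • d)) ⟪u, d⟫ t := by
  have h1 : HasDerivAt (fun s : ℝ => p + s • d) d t := by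
    simpa using ((hasDerivAt_id t).smul_const d).const_add p
  simpa [Function.comp_def] using (hasGradientAt_iff_hasFDerivAt.1 h).comp_hasDerivAt t h1

/-- First-order consequence of an inequality along a segment. -/
theorem inner_add_nonneg_of_segment {φ : X → ℝ} {u p d : X} {A C : ℝ}
    (h : HasGradientAt φ u p)
    (hle : ∀ t : ℝ, 0 < t → t < 1 → φ p ≤ φ (p + t • d) + t * (A + C * (1 - t))) :
    0 ≤ ⟪u, d⟫ + (A + C) := by
  have h1 : HasDerivAt (fun s : ℝ => φ (p + s • d)) ⟪u, d⟫ 0 := hasDerivAt_line (by simpa using h)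
  have h2 := h1.tendsto_slope_zero_right
  have h3 : Tendsto (fun t : ℝ => A + C * (1 - t)) (𝓝[>] 0) (𝓝 (A + C)) := by
    have : ContinuousAt (fun t : ℝ => A + C * (1 - t)) 0 := by fun_prop
    simpa [ContinuousAt] using this.mono_left nhdsWithin_le_nhds
  refine ge_of_tendsto (h2.add h3) ?_
  filter_upwards [Ioo_mem_nhdsGT (zero_lt_one' ℝ)] with t ht
  have h4 := hle t ht.1 ht.2
  have h5 : t⁻¹ • (φ (p + (0 + t) • d) - φ (p + (0 : ℝ) • d)) + (A + C * (1 - t)) =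
      t⁻¹ * (φ (p + t • d) + t * (A + C * (1 - t)) - φ p) := by
    have := ht.1.ne'
    simp only [zero_add, zero_smul, add_zero, smul_eq_mul]
    field_simp
    ring
  rw [h5]
  exact mul_nonneg (inv_nonneg.2 ht.1.le) (by linarith)

/-- The segment lemma is applied to `-f`, so that strong convexity supplies its hypothesis. -/
theorem le_of_strongConvexOn {f : X → ℝ} {μ : ℝ} (hf : StrongConvexOn univ μ f) {u x : X}
    (hu : HasGradientAt f u x) (y : X) :
    f x + ⟪u, y - x⟫ + μ / 2 * ‖y - x‖ ^ 2 ≤ f y := by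
  have h := inner_add_nonneg_of_segment (d := y - x) (A := f y - f x)
    (C := -(μ / 2 * ‖y - x‖ ^ 2)) (hasGradientAt_neg hu) fun t h0 h1 => by
      have := hf.2 (mem_univ x) (mem_univ y) (sub_nonneg.2 h1.le) h0.le (by ring)
      have e : (1 - t) • x + t • y = x + t • (y - x) := by module
      rw [e, norm_sub_rev x y, smul_eq_mul, smul_eq_mul] at this
      linarith
  rw [inner_neg_left] at h
  linarith

/-- The descent lemma. -/
theorem le_of_lipschitz_gradient {f : X → ℝ} {β : ℝ} (hfd : Differentiable ℝ f)
    (hfL : ∀ x y, ‖∇ f x - ∇ f y‖ ≤ β * ‖x - y‖) (x y : X) :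
    f y ≤ f x + ⟪∇ f x, y - x⟫ + β / 2 * ‖y - x‖ ^ 2 := by
  set d := y - x with hd
  have hder : ∀ t : ℝ, HasDerivAt
      (fun s : ℝ => f (x + s • d) - (s * ⟪∇ f x, d⟫ + β / 2 * ‖d‖ ^ 2 * s ^ 2))
      (⟪∇ f (x + t • d), d⟫ - (1 * ⟪∇ f x, d⟫ + β / 2 * ‖d‖ ^ 2 * (2 * t))) t := fun t => by
    refine (hasDerivAt_line (hfd _).hasGradientAt).sub
      (((hasDerivAt_id t).mul_const _).add (HasDerivAt.const_mul _ ?_))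
    simpa using hasDerivAt_pow 2 t
  -- The derivative is `⟪∇f (x + t d) - ∇f x, d⟫ - β t ‖d‖²`, nonpositive by Cauchy–Schwarz and the
  -- Lipschitz bound.
  have hanti : AntitoneOn
      (fun s : ℝ => f (x + s • d) - (s * ⟪∇ f x, d⟫ + β / 2 * ‖d‖ ^ 2 * s ^ 2)) (Icc 0 1) := by
    refine antitoneOn_of_deriv_nonpos (convex_Icc 0 1)
      (fun t _ => (hder t).continuousAt.continuousWithinAt)
      (fun t _ => (hder t).differentiableAt.differentiableWithinAt) fun t ht => ?_
    rw [interior_Icc] at ht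
    rw [(hder t).deriv]
    have h1 := real_inner_le_norm (∇ f (x + t • d) - ∇ f x) d
    have h2 := hfL (x + t • d) x
    rw [add_sub_cancel_left, norm_smul, Real.norm_eq_abs, abs_of_pos ht.1] at h2
    have h3 := mul_le_mul_of_nonneg_right h2 (norm_nonneg d)
    rw [inner_sub_left] at h1
    nlinarith
  have h := hanti (left_mem_Icc.2 zero_le_one) (right_mem_Icc.2 zero_le_one) zero_le_one
  have e : x + (1 : ℝ) • d = y := by rw [hd]; module
  simp only [e, zero_smul, add_zero] at h
  linarith

/-- Baillon--Haddad for `f - μ/2 ‖·‖²`. -/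
theorem cocoercive_gradient {f : X → ℝ} {μ β : ℝ} (hμ : 0 ≤ μ) (hβ : 0 < β)
    (hf : StrongConvexOn univ μ f) (hfd : Differentiable ℝ f)
    (hfL : ∀ x y, ‖∇ f x - ∇ f y‖ ≤ β * ‖x - y‖) (x y : X) :
    ‖(∇ f x - ∇ f y) - μ • (x - y)‖ ^ 2 ≤ β * ⟪(∇ f x - ∇ f y) - μ • (x - y), x - y⟫ := by
  -- The value of `f` at `y + β⁻¹ e` is bounded below by strong convexity at `x` and above by the
  -- descent lemma at `y`. Discarding the term `μ/2 ‖β⁻¹ e‖²` costs the sharp constant `β - μ`, but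
  -- `β` is exactly what the bound on `γ` requires.
  have key : ∀ x y : X, f x + ⟪∇ f x, y - x⟫ + μ / 2 * ‖y - x‖ ^ 2
      + ‖(∇ f x - ∇ f y) - μ • (x - y)‖ ^ 2 / (2 * β) ≤ f y := by
    intro x y
    set e := (∇ f x - ∇ f y) - μ • (x - y) with he
    have h1 := le_of_strongConvexOn hf (hfd x).hasGradientAt (y + β⁻¹ • e)
    have h2 := le_of_lipschitz_gradient hfd hfL y (y + β⁻¹ • e)
    have e1 : y + β⁻¹ • e - x = (y - x) + β⁻¹ • e := by abel
    have e2 : ∇ f x = ∇ f y + μ • (x - y) + e := by rw [he]; abel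
    have e3 : ⟪∇ f x, e⟫ = ⟪∇ f y, e⟫ - μ * ⟪y - x, e⟫ + ‖e‖ ^ 2 := by
      rw [e2, inner_add_left, inner_add_left, real_inner_smul_left, real_inner_self_eq_norm_sq,
        ← neg_sub y x, inner_neg_left]
      ring
    rw [e1, inner_add_right, norm_add_sq_real, real_inner_smul_right, real_inner_smul_right,
      norm_smul, Real.norm_eq_abs, abs_of_pos (inv_pos.2 hβ), e3] at h1
    rw [add_sub_cancel_left, real_inner_smul_right, norm_smul, Real.norm_eq_abs,
      abs_of_pos (inv_pos.2 hβ)] at h2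
    have h3 : 0 ≤ μ / 2 * (β⁻¹ * ‖e‖) ^ 2 := by positivity
    have h4 : β / 2 * (β⁻¹ * ‖e‖) ^ 2 = β⁻¹ * ‖e‖ ^ 2 / 2 := by field_simp
    have h5 : ‖e‖ ^ 2 / (2 * β) = β⁻¹ * ‖e‖ ^ 2 / 2 := by field_simp
    rw [h5]
    rw [h4] at h2
    linarith
  have h1 := key x y
  have h2 := key y x
  have e1 : (∇ f y - ∇ f x) - μ • (y - x) = -((∇ f x - ∇ f y) - μ • (x - y)) := by module
  rw [e1, norm_neg] at h2
  rw [norm_sub_rev y x, ← neg_sub x y, inner_neg_right] at h1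
  set e := (∇ f x - ∇ f y) - μ • (x - y) with he
  have h3 : ⟪e, x - y⟫ = ⟪∇ f x, x - y⟫ - ⟪∇ f y, x - y⟫ - μ * ‖x - y‖ ^ 2 := by
    rw [he, inner_sub_left, inner_sub_left, real_inner_smul_left, real_inner_self_eq_norm_sq]
  have h4 : ‖e‖ ^ 2 / β ≤ ⟪e, x - y⟫ := by
    have h5 : ‖e‖ ^ 2 / β = ‖e‖ ^ 2 / (2 * β) + ‖e‖ ^ 2 / (2 * β) := by field_simp; ring
    linarith
  rwa [div_le_iff₀ hβ, mul_comm] at h4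

end Smooth

/-! ### Hypoconvex functions -/

section Hypoconvex

variable {g : X → EReal} {ω : ℝ}

theorem IsProper.eq_coe_of_ne_top (hp : IsProper g) {x : X} (hx : g x ≠ ⊤) :
    ∃ a : ℝ, g x = a :=
  ⟨_, (EReal.coe_toReal hx (hp.1 x)).symm⟩

theorem IsHypoconvex.exists_coe_le (hg : IsHypoconvex ω g) (hp : IsProper g) {x y : X} {a b : ℝ}
    (hx : g x = a) (hy : g y = b) {t : ℝ} (h0 : 0 < t) (h1 : t < 1) :
    ∃ c : ℝ, g ((1 - t) • x + t • y) = c ∧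
      c ≤ (1 - t) * a + t * b + ω / 2 * (t * (1 - t)) * ‖x - y‖ ^ 2 := by
  have h := hg x y t h0 h1
  rw [hx, hy, ← EReal.coe_mul, ← EReal.coe_mul, ← EReal.coe_add, ← EReal.coe_add] at h
  obtain ⟨c, hc⟩ := hp.eq_coe_of_ne_top (ne_top_of_le_ne_top (EReal.coe_ne_top _) h)
  refine ⟨c, hc, ?_⟩
  rwa [hc, EReal.coe_le_coe_iff] at h

/-- `u` is a subgradient of the `ω`-hypoconvex function `g` at `p`. -/
def IsHypoSubgradient (ω : ℝ) (g : X → EReal) (p u : X) : Prop :=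
  ∃ a : ℝ, g p = a ∧ ∀ (y : X) (b : ℝ), g y = b → a + ⟪u, y - p⟫ - ω / 2 * ‖y - p‖ ^ 2 ≤ b

theorem IsHypoSubgradient.inner_sub_le {p q u v : X} (h₁ : IsHypoSubgradient ω g p u)
    (h₂ : IsHypoSubgradient ω g q v) : -(ω * ‖p - q‖ ^ 2) ≤ ⟪u - v, p - q⟫ := by
  obtain ⟨a, ha, h₁⟩ := h₁
  obtain ⟨b, hb, h₂⟩ := h₂
  have h3 := h₁ q b hb
  have h4 := h₂ p a ha
  rw [norm_sub_rev q p, ← neg_sub p q, inner_neg_right] at h3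
  rw [inner_sub_left]
  linarith

/-- Convexity of `φ` plays no role: minimality along the segment from `p` to `y`, with hypoconvexity
of `g`, gives a first-order inequality. It serves for `φ = f` and for the prox quadratic. -/
theorem isHypoSubgradient_of_mem_argmin [CompleteSpace X] (hp : IsProper g)
    (hg : IsHypoconvex ω g) {φ : X → ℝ} {p u : X} (hφ : HasGradientAt φ u p)
    (h : p ∈ argmin fun y => (φ y : EReal) + g y) : IsHypoSubgradient ω g p (-u) := by
  have hpt : g p ≠ ⊤ := fun htop => by
    obtain ⟨y, hy⟩ := hp.2
    obtain ⟨b, hb⟩ := hp.eq_coe_of_ne_top hy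
    have := h y
    simp only [htop, hb, EReal.coe_add_top, top_le_iff, ← EReal.coe_add] at this
    exact EReal.coe_ne_top _ this
  obtain ⟨a, ha⟩ := hp.eq_coe_of_ne_top hpt
  refine ⟨a, ha, fun y b hb => ?_⟩
  have h1 := inner_add_nonneg_of_segment (d := y - p) (A := b - a)
    (C := ω / 2 * ‖y - p‖ ^ 2) hφ fun t h0 h1 => by
      obtain ⟨c, hc, hle⟩ := hg.exists_coe_le hp ha hb h0 h1
      have e : (1 - t) • p + t • y = p + t • (y - p) := by module
      have h2 := h ((1 - t) • p + t • y)
      simp only [ha, hc, ← EReal.coe_add, EReal.coe_le_coe_iff] at h2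
      rw [e] at h2
      rw [norm_sub_rev p y] at hle
      linarith
  rw [inner_neg_left]
  linarith

theorem mem_argmin_of_isHypoSubgradient (hp : IsProper g) {φ : X → ℝ} {p u : X}
    (hφ : ∀ y, φ p + ⟪u, y - p⟫ + ω / 2 * ‖y - p‖ ^ 2 ≤ φ y)
    (h : IsHypoSubgradient ω g p (-u)) : p ∈ argmin fun y => (φ y : EReal) + g y := by
  obtain ⟨a, ha, h⟩ := h
  intro y
  by_cases hy : g y = ⊤
  · simp [hy]
  obtain ⟨b, hb⟩ := hp.eq_coe_of_ne_top hy
  simp only [ha, hb, ← EReal.coe_add, EReal.coe_le_coe_iff]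
  have h1 := h y b hb
  rw [inner_neg_left] at h1
  linarith [hφ y]

/-- The axioms `eq_convex` and `add_quadratic`, applied to the convex function `g + ω/2 ‖·‖²`, leave
no freedom in `S.subdiff g`. -/
theorem mem_subdiff_iff [CompleteSpace X] (S : AbstractSubdifferential X) (hp : IsProper g)
    (hl : LowerSemicontinuous g) (hg : IsHypoconvex ω g) {x u : X} :
    u ∈ S.subdiff g x ↔ IsHypoSubgradient ω g x u := by
  set q : X → ℝ := fun y => ω * (‖y - 0‖ ^ 2 / 2) with hq
  set h : X → EReal := fun y => g y + (q y : EReal) with hh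
  have hproper : IsProper h := by
    refine ⟨fun y => ?_, ?_⟩
    · simp [hh, EReal.add_eq_bot_iff, hp.1 y]
    · obtain ⟨y, hy⟩ := hp.2
      exact ⟨y, EReal.add_ne_top hy (EReal.coe_ne_top _)⟩
  have hlsc : LowerSemicontinuous h := by
    refine LowerSemicontinuous.add' hl
      (continuous_coe_real_ereal.comp (by fun_prop : Continuous q)).lowerSemicontinuous fun y => ?_
    exact EReal.continuousAt_add (Or.inr (EReal.coe_ne_bot _)) (Or.inr (EReal.coe_ne_top _))
  have hconv : IsHypoconvex 0 h := by
    intro y z t h0 h1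
    by_cases hy : g y = ⊤
    · have : ((1 - t : ℝ) : EReal) * h y + (t : EReal) * h z = ⊤ := by
        rw [hh]
        simp only [hy, EReal.top_add_coe]
        rw [EReal.coe_mul_top_of_pos (by linarith)]
        refine EReal.top_add_of_ne_bot ?_
        by_cases hz : g z = ⊤
        · rw [hz, EReal.top_add_coe, EReal.coe_mul_top_of_pos h0]; simp
        · obtain ⟨b, hb⟩ := hp.eq_coe_of_ne_top hz
          rw [hb, ← EReal.coe_add, ← EReal.coe_mul]; exact EReal.coe_ne_bot _
      rw [this, EReal.top_add_coe]; exact le_top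
    obtain ⟨a, ha⟩ := hp.eq_coe_of_ne_top hy
    by_cases hz : g z = ⊤
    · have : ((1 - t : ℝ) : EReal) * h y + (t : EReal) * h z = ⊤ := by
        rw [hh]
        simp only [hz, ha, EReal.top_add_coe]
        rw [EReal.coe_mul_top_of_pos h0, ← EReal.coe_add, ← EReal.coe_mul, EReal.coe_add_top]
      rw [this, EReal.top_add_coe]; exact le_top
    obtain ⟨b, hb⟩ := hp.eq_coe_of_ne_top hz
    obtain ⟨c, hc, hle⟩ := hg.exists_coe_le hp ha hb h0 h1
    simp only [hh, ha, hb, hc, hq, ← EReal.coe_add, ← EReal.coe_mul, EReal.coe_le_coe_iff,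
      sub_zero]
    have e : ‖(1 - t) • y + t • z‖ ^ 2 = (1 - t) * ‖y‖ ^ 2 + t * ‖z‖ ^ 2
        - t * (1 - t) * ‖y - z‖ ^ 2 := by
      rw [norm_add_sq_real, norm_sub_sq_real, norm_smul, norm_smul, real_inner_smul_left,
        real_inner_smul_right, Real.norm_eq_abs, Real.norm_eq_abs, abs_of_pos h0,
        abs_of_pos (sub_pos.2 h1)]
      ring
    rw [e]
    linarith
  have hS : u ∈ S.subdiff g x ↔ u + ω • x ∈ convexSubdifferential h x := by
    rw [← S.eq_convex h hproper hlsc hconv x, S.add_quadratic g hp hl ω 0 x, sub_zero,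
      add_singleton, image_add_right, mem_preimage, add_neg_cancel_right]
  have key : ∀ y, (q x + ⟪u + ω • x, y - x⟫) - q y = ⟪u, y - x⟫ - ω / 2 * ‖y - x‖ ^ 2 := by
    intro y
    simp only [hq, sub_zero]
    rw [inner_add_left, real_inner_smul_left, inner_sub_right x, real_inner_self_eq_norm_sq,
      norm_sub_sq_real, real_inner_comm y x]
    ring
  rw [hS]
  constructor
  · intro hu
    have hx : g x ≠ ⊤ := fun htop => by
      obtain ⟨y, hy⟩ := hproper.2
      have h1 := hu y
      simp only [hh, htop, EReal.top_add_coe, top_le_iff] at h1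
      exact hy h1
    obtain ⟨a, ha⟩ := hp.eq_coe_of_ne_top hx
    refine ⟨a, ha, fun y b hb => ?_⟩
    have h1 := hu y
    simp only [hh, ha, hb, ← EReal.coe_add, EReal.coe_le_coe_iff] at h1
    linarith [key y]
  · rintro ⟨a, ha, hu⟩ y
    by_cases hy : g y = ⊤
    · simp [hh, hy]
    obtain ⟨b, hb⟩ := hp.eq_coe_of_ne_top hy
    simp only [hh, ha, hb, ← EReal.coe_add, EReal.coe_le_coe_iff]
    linarith [key y, hu y b hb]

end Hypoconvex

/-! ### The proximal mapping -/

section Prox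

variable {g : X → EReal} {ω γ : ℝ}

theorem hasGradientAt_sq_dist [CompleteSpace X] (γ : ℝ) (x p : X) :
    HasGradientAt (fun y : X => 1 / (2 * γ) * ‖x - y‖ ^ 2) (-(γ⁻¹ • (x - p))) p := by
  rw [hasGradientAt_iff_hasFDerivAt]
  have h1 : HasFDerivAt (fun y : X => x - y) (-ContinuousLinearMap.id ℝ X) p :=
    (hasFDerivAt_id p).const_sub x
  refine (h1.norm_sq.const_mul (1 / (2 * γ))).congr_fderiv ?_
  ext v
  simp
  ring

theorem mem_prox_iff [CompleteSpace X] (hp : IsProper g) (hg : IsHypoconvex ω g) (hγ : 0 < γ)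
    (hγω : γ * ω ≤ 1) {x p : X} :
    p ∈ prox γ g x ↔ IsHypoSubgradient ω g p (γ⁻¹ • (x - p)) := by
  have e : (fun y => g y + ((1 / (2 * γ) * ‖x - y‖ ^ 2 : ℝ) : EReal)) =
      fun y => ((1 / (2 * γ) * ‖x - y‖ ^ 2 : ℝ) : EReal) + g y := by
    funext y; rw [add_comm]
  rw [prox, e]
  constructor
  · intro h
    simpa using isHypoSubgradient_of_mem_argmin hp hg (hasGradientAt_sq_dist γ x p) h
  · intro h
    refine mem_argmin_of_isHypoSubgradient (ω := ω) (u := -(γ⁻¹ • (x - p))) hp (fun y => ?_)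
      (by simpa using h)
    have e1 : x - y = (x - p) - (y - p) := by abel
    have h1 : ω ≤ γ⁻¹ := by rw [← one_div, le_div_iff₀ hγ]; linarith
    have h2 : 1 / (2 * γ) = γ⁻¹ / 2 := by field_simp
    rw [e1, norm_sub_sq_real (x - p), inner_neg_left, real_inner_smul_left, h2]
    have h3 := mul_le_mul_of_nonneg_right h1 (sq_nonneg ‖y - p‖)
    linarith

/-- Hypomonotonicity of the subgradients `γ⁻¹ (x - p)` and `γ⁻¹ (y - q)`, multiplied by `γ`. -/
theorem mul_norm_sq_le_inner_of_mem_prox [CompleteSpace X] (hp : IsProper g)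
    (hg : IsHypoconvex ω g) (hγ : 0 < γ) (hγω : γ * ω ≤ 1) {x y p q : X}
    (hx : p ∈ prox γ g x) (hy : q ∈ prox γ g y) :
    (1 - γ * ω) * ‖p - q‖ ^ 2 ≤ ⟪x - y, p - q⟫ := by
  have h := ((mem_prox_iff hp hg hγ hγω).1 hx).inner_sub_le ((mem_prox_iff hp hg hγ hγω).1 hy)
  have e : γ⁻¹ • (x - p) - γ⁻¹ • (y - q) = γ⁻¹ • ((x - y) - (p - q)) := by module
  rw [e, real_inner_smul_left, inner_sub_left, real_inner_self_eq_norm_sq] at h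
  have h1 := mul_le_mul_of_nonneg_left h hγ.le
  rw [mul_inv_cancel_left₀ hγ.ne'] at h1
  linarith

/-- The proximal mapping of a hypoconvex function with a subgradient is nonempty-valued. -/
theorem prox_nonempty [CompleteSpace X] (hp : IsProper g) (hl : LowerSemicontinuous g)
    (hg : IsHypoconvex ω g) (hγ : 0 < γ) (hγω : γ * ω < 1) {z u : X}
    (hu : IsHypoSubgradient ω g z u) (x : X) : (prox γ g x).Nonempty := by
  set σ : ℝ := γ⁻¹ - ω with hσ
  have hσpos : 0 < σ := by
    rw [hσ, sub_pos, ← one_div, lt_div_iff₀ hγ]; linarith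
  have h2γ : 1 / (2 * γ) = γ⁻¹ / 2 := by field_simp
  set R : Set ℝ := {r | ∃ y, ∃ b : ℝ, g y = b ∧ r = b + γ⁻¹ / 2 * ‖x - y‖ ^ 2} with hR
  obtain ⟨a, ha, hu⟩ := hu
  have hRne : R.Nonempty := ⟨_, z, a, ha, rfl⟩
  -- The subgradient at `z` bounds the objective below by a quadratic in `‖y - z‖` with leading
  -- coefficient `σ/2 > 0`; the bound is its minimum, by completing the square.
  have hbdd : BddBelow R := by
    refine ⟨a + γ⁻¹ / 2 * ‖x - z‖ ^ 2 - ‖u - γ⁻¹ • (x - z)‖ ^ 2 / (2 * σ), ?_⟩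
    rintro _ ⟨y, b, hb, rfl⟩
    have h1 := hu y b hb
    have e1 : x - y = (x - z) - (y - z) := by abel
    rw [e1, norm_sub_sq_real (x - z)]
    have h2 : -(‖u - γ⁻¹ • (x - z)‖ * ‖y - z‖) ≤ ⟪u - γ⁻¹ • (x - z), y - z⟫ :=
      (abs_le.1 (abs_real_inner_le_norm _ _)).1
    have h3 : 0 ≤ (‖u - γ⁻¹ • (x - z)‖ - σ * ‖y - z‖) ^ 2 / (2 * σ) := by positivity
    have h4 : (‖u - γ⁻¹ • (x - z)‖ - σ * ‖y - z‖) ^ 2 / (2 * σ) =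
        ‖u - γ⁻¹ • (x - z)‖ ^ 2 / (2 * σ) - ‖u - γ⁻¹ • (x - z)‖ * ‖y - z‖
          + σ / 2 * ‖y - z‖ ^ 2 := by
      field_simp
      ring
    have h5 : σ / 2 * ‖y - z‖ ^ 2 = γ⁻¹ / 2 * ‖y - z‖ ^ 2 - ω / 2 * ‖y - z‖ ^ 2 := by
      rw [hσ]; ring
    rw [inner_sub_left, real_inner_smul_left] at h2
    linarith
  set m := sInf R with hm
  -- The objective is `σ`-strongly convex and its value at the midpoint is at least `m`, so
  -- near-minimizers are close and minimizing sequences are Cauchy.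
  have hmid : ∀ y z b c, g y = ((b : ℝ) : EReal) → g z = ((c : ℝ) : EReal) →
      σ / 4 * ‖y - z‖ ^ 2 ≤ (b + γ⁻¹ / 2 * ‖x - y‖ ^ 2 - m) + (c + γ⁻¹ / 2 * ‖x - z‖ ^ 2 - m) := by
    intro y z b c hb hc
    obtain ⟨d, hd, hle⟩ := hg.exists_coe_le hp hb hc (t := 1 / 2) (by norm_num) (by norm_num)
    have h1 : m ≤ _ := csInf_le hbdd ⟨_, d, hd, rfl⟩
    have e1 : x - ((1 - 1 / 2 : ℝ) • y + (1 / 2 : ℝ) • z) =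
        (1 / 2 : ℝ) • ((x - y) + (x - z)) := by module
    have e2 : y - z = (x - z) - (x - y) := by abel
    rw [e1, norm_smul, mul_pow, norm_add_sq_real] at h1
    rw [e2, norm_sub_sq_real, real_inner_comm] at hle ⊢
    norm_num at h1 hle
    rw [hσ]
    nlinarith
  have hex : ∀ n : ℕ, ∃ y, ∃ b : ℝ, g y = b ∧ b + γ⁻¹ / 2 * ‖x - y‖ ^ 2 < m + 1 / ((n : ℝ) + 1) :=
    fun n => by
      obtain ⟨_, ⟨y, b, hb, rfl⟩, hlt⟩ := exists_lt_of_csInf_lt hRne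
        (lt_add_of_pos_right m (Nat.one_div_pos_of_nat (α := ℝ) (n := n)))
      exact ⟨y, b, hb, hlt⟩
  choose y b hb hlt using hex
  have hcauchy : CauchySeq y := by
    refine cauchySeq_of_le_tendsto_0 (fun n : ℕ => √(8 / σ * (1 / ((n : ℝ) + 1))))
      (fun n k N hn hk => ?_) ?_
    · rw [dist_eq_norm]
      refine Real.le_sqrt_of_sq_le ?_
      have h1 := hmid _ _ _ _ (hb n) (hb k)
      have h2 := Nat.one_div_le_one_div (α := ℝ) hn
      have h3 := Nat.one_div_le_one_div (α := ℝ) hk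
      have h4 : σ / 4 * ‖y n - y k‖ ^ 2 ≤ 2 * (1 / ((N : ℝ) + 1)) := by
        linarith [hlt n, hlt k]
      rw [div_mul_eq_mul_div, le_div_iff₀ hσpos]
      linarith
    · have := (tendsto_one_div_add_atTop_nhds_zero_nat (𝕜 := ℝ)).const_mul (8 / σ)
      simpa using this.sqrt
  obtain ⟨p, hpl⟩ := cauchySeq_tendsto_of_complete hcauchy
  -- Lower semicontinuity passes the bound on `g (y n)` to the limit `p`.
  have hgp : g p ≤ ((m - γ⁻¹ / 2 * ‖x - p‖ ^ 2 : ℝ) : EReal) := by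
    by_contra! hcon
    obtain ⟨c, hc1, hc2⟩ := EReal.lt_iff_exists_real_btwn.1 hcon
    rw [EReal.coe_lt_coe_iff] at hc1
    have h1 : ∀ᶠ n in atTop, (c : EReal) < g (y n) := hpl.eventually (hl p c hc2)
    have h2 : Tendsto (fun n : ℕ => m + 1 / ((n : ℝ) + 1) - γ⁻¹ / 2 * ‖x - y n‖ ^ 2) atTop
        (𝓝 (m + 0 - γ⁻¹ / 2 * ‖x - p‖ ^ 2)) :=
      (tendsto_one_div_add_atTop_nhds_zero_nat.const_add m).sub
        (((hpl.const_sub x).norm.pow 2).const_mul _)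
    rw [add_zero] at h2
    refine absurd (ge_of_tendsto h2 ?_) (not_le.2 hc1)
    filter_upwards [h1] with n hn
    rw [hb n, EReal.coe_lt_coe_iff] at hn
    linarith [hlt n]
  obtain ⟨c, hc⟩ := hp.eq_coe_of_ne_top (ne_top_of_le_ne_top (EReal.coe_ne_top _) hgp)
  rw [hc, EReal.coe_le_coe_iff] at hgp
  refine ⟨p, fun y => ?_⟩
  by_cases hy : g y = ⊤
  · simp only [hy, EReal.top_add_coe, le_top]
  obtain ⟨d, hd⟩ := hp.eq_coe_of_ne_top hy
  have h1 : m ≤ _ := csInf_le hbdd ⟨y, d, hd, rfl⟩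
  simp only [hc, hd, h2γ, ← EReal.coe_add, EReal.coe_le_coe_iff]
  linarith

end Prox

end ForwardBackward

namespace ForwardBackward

variable {X : Type*} [NormedAddCommGroup X] [InnerProductSpace ℝ X]

/-! ### The forward-backward step -/

section Step

variable {μ ω β γ : ℝ} {d e t : X}

/-- Here `d = x - y` and `e` is the increment of `∇f - μ Id`, so `(1 - γμ) d - γ e` is the increment
of the forward step; below, `t` is that of `T`. -/
theorem norm_sq_forward_le (hβ : 0 < β) (hγ : 0 < γ) (hα : 0 < 1 - γ * μ)
    (he : ‖e‖ ^ 2 ≤ β * ⟪e, d⟫) :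
    ‖(1 - γ * μ) • d - γ • e‖ ^ 2 ≤ (1 - γ * μ) ^ 2 * ‖d‖ ^ 2
      - γ * (2 * (1 - γ * μ) / β - γ) * ‖e‖ ^ 2 := by
  rw [norm_sub_sq_real, norm_smul, norm_smul, real_inner_smul_left, real_inner_smul_right,
    Real.norm_eq_abs, Real.norm_eq_abs, abs_of_pos hγ, abs_of_pos hα, real_inner_comm]
  have h1 : ‖e‖ ^ 2 / β ≤ ⟪e, d⟫ := by rwa [div_le_iff₀ hβ, mul_comm]
  have h2 := mul_le_mul_of_nonneg_left h1 (by positivity : 0 ≤ 2 * γ * (1 - γ * μ))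
  have h3 : γ * (2 * (1 - γ * μ) / β - γ) * ‖e‖ ^ 2 =
      2 * γ * (1 - γ * μ) * (‖e‖ ^ 2 / β) - γ ^ 2 * ‖e‖ ^ 2 := by
    field_simp
  rw [h3]
  linarith

theorem norm_backward_le (hβ : 0 < β) (hγ : 0 < γ) (hα : 0 < 1 - γ * μ) (hω : 0 < 1 - γ * ω)
    (hκ : 0 < 2 * (1 - γ * μ) / β - γ) (he : ‖e‖ ^ 2 ≤ β * ⟪e, d⟫)
    (ht : (1 - γ * ω) * ‖t‖ ^ 2 ≤ ⟪(1 - γ * μ) • d - γ • e, t⟫) :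
    ‖t‖ ≤ (1 - γ * μ) / (1 - γ * ω) * ‖d‖ := by
  have h1 := norm_sq_forward_le hβ hγ hα he
  have h2 : ‖(1 - γ * μ) • d - γ • e‖ ≤ (1 - γ * μ) * ‖d‖ := by
    refine (sq_le_sq₀ (norm_nonneg _) (by positivity)).1 ?_
    have : 0 ≤ γ * (2 * (1 - γ * μ) / β - γ) * ‖e‖ ^ 2 := by positivity
    linarith
  rw [div_mul_eq_mul_div, le_div_iff₀ hω]
  rcases (norm_nonneg t).eq_or_lt with h0 | h0
  · rw [← h0, zero_mul]; positivity
  have h3 := ht.trans (real_inner_le_norm _ _)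
  refine le_trans ?_ h2
  refine le_of_mul_le_mul_right ?_ h0
  linarith

/-- With `α = 1 - γμ`, both `‖s - α t‖²` and `γκ ‖e‖²` are controlled by `α² (‖d‖² - ‖t‖²)`, and `α
(d - t) = (s - α t) + γ e`. Squaring gives coefficients `2` and `2γ² = (2γ/κ) γκ`, whose constants
add up to the one stated. -/
theorem norm_sq_sub_le (hβ : 0 < β) (hγ : 0 < γ) (hα : 0 < 1 - γ * μ) (hμω : ω ≤ μ)
    (hκ : 0 < 2 * (1 - γ * μ) / β - γ) (he : ‖e‖ ^ 2 ≤ β * ⟪e, d⟫)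
    (ht : (1 - γ * ω) * ‖t‖ ^ 2 ≤ ⟪(1 - γ * μ) • d - γ • e, t⟫) :
    ‖d - t‖ ^ 2 ≤ (2 + 2 * γ / (2 * (1 - γ * μ) / β - γ)) * (‖d‖ ^ 2 - ‖t‖ ^ 2) := by
  set κ := 2 * (1 - γ * μ) / β - γ with hκ'
  set α := 1 - γ * μ with hα'
  set s := α • d - γ • e with hs
  have h1 : ‖s‖ ^ 2 ≤ α ^ 2 * ‖d‖ ^ 2 - γ * κ * ‖e‖ ^ 2 := norm_sq_forward_le hβ hγ hα he
  have h2 : α * ‖t‖ ^ 2 ≤ ⟪s, t⟫ := by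
    refine le_trans (mul_le_mul_of_nonneg_right ?_ (sq_nonneg _)) ht
    have := mul_le_mul_of_nonneg_left hμω hγ.le
    linarith
  have h3 : ‖s - α • t‖ ^ 2 = ‖s‖ ^ 2 - 2 * (α * ⟪s, t⟫) + α ^ 2 * ‖t‖ ^ 2 := by
    rw [norm_sub_sq_real, real_inner_smul_right, norm_smul, Real.norm_eq_abs, abs_of_pos hα,
      mul_pow]
  have h4 := mul_le_mul_of_nonneg_left h2 hα.le
  have h5 : γ * κ * ‖e‖ ^ 2 + ‖s - α • t‖ ^ 2 ≤ α ^ 2 * (‖d‖ ^ 2 - ‖t‖ ^ 2) := by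
    rw [h3]; linarith
  have h6 : α • (d - t) = (s - α • t) + γ • e := by rw [hs]; module
  have h7 : α ^ 2 * ‖d - t‖ ^ 2 ≤ 2 * ‖s - α • t‖ ^ 2 + 2 * (γ ^ 2 * ‖e‖ ^ 2) := by
    have h8 := norm_add_le (s - α • t) (γ • e)
    rw [← h6, norm_smul, norm_smul, Real.norm_eq_abs, Real.norm_eq_abs, abs_of_pos hα,
      abs_of_pos hγ] at h8
    have h9 := pow_le_pow_left₀ (by positivity) h8 2
    linarith [sq_nonneg (‖s - α • t‖ - γ * ‖e‖)]
  have h8 : 2 * (γ ^ 2 * ‖e‖ ^ 2) = 2 * γ / κ * (γ * κ * ‖e‖ ^ 2) := by field_simp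
  have h9 : 0 ≤ 2 * γ / κ := by positivity
  have h10 : 0 ≤ γ * κ * ‖e‖ ^ 2 := by positivity
  have h11 := mul_le_mul_of_nonneg_left h5 (by positivity : 0 ≤ 2 + 2 * γ / κ)
  have h12 : 0 ≤ 2 * γ / κ * ‖s - α • t‖ ^ 2 := by positivity
  refine le_of_mul_le_mul_left ?_ (pow_pos hα 2)
  linarith

end Step

end ForwardBackward

/-! ### Convergence of the forward-backward iteration -/

theorem mainTheorem12 {X : Type*} [NormedAddCommGroup X] [InnerProductSpace ℝ X] [CompleteSpace X]
    (μ ω β γ : ℝ) (hω : 0 ≤ ω) (hμω : ω ≤ μ) (hβ : 0 < β)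
    (f : X → ℝ) (hf : StrongConvexOn Set.univ μ f) (hfd : Differentiable ℝ f)
    (hfL : ∀ x y, ‖∇ f x - ∇ f y‖ ≤ β * ‖x - y‖)
    (g : X → EReal) (hgp : ForwardBackward.IsProper g) (hgl : LowerSemicontinuous g)
    (hg : ForwardBackward.IsHypoconvex ω g)
    (hne : (ForwardBackward.argmin fun x => (f x : EReal) + g x).Nonempty)
    (hγ : 0 < γ) (hγ' : γ < 2 / (β + 2 * μ)) :
    ∃ P T : X → X,
      -- the proximal mapping is single-valued with full domain, and `T` is the
      -- forward-backward operator
      (∀ x, ForwardBackward.prox γ g x = {P x}) ∧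
      (∀ x, T x = P (x - γ • ∇ f x)) ∧
      Function.fixedPoints T = ForwardBackward.argmin (fun x => (f x : EReal) + g x) ∧
      (∀ S : ForwardBackward.AbstractSubdifferential X,
        Function.fixedPoints T = ForwardBackward.zer (fun x => {∇ f x} + S.subdiff g x)) ∧
      ∀ x₀ : X, ∃ xbar ∈ Function.fixedPoints T,
        Tendsto (fun n : ℕ => toWeakSpace ℝ X (T^[n] x₀)) atTop (𝓝 (toWeakSpace ℝ X xbar)) ∧
        (ω < μ →
          Function.fixedPoints T = {xbar} ∧
          ForwardBackward.argmin (fun x => (f x : EReal) + g x) = {xbar} ∧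
          0 < (1 - γ * μ) / (1 - γ * ω) ∧ (1 - γ * μ) / (1 - γ * ω) < 1 ∧
          Tendsto (fun n : ℕ => T^[n] x₀) atTop (𝓝 xbar) ∧
          (∀ n : ℕ, ‖T^[n + 1] x₀ - xbar‖ ≤
            (1 - γ * μ) / (1 - γ * ω) * ‖T^[n] x₀ - xbar‖) ∧
          ∀ n : ℕ, ‖T^[n] x₀ - xbar‖ ≤
            ((1 - γ * μ) / (1 - γ * ω)) ^ n * ‖x₀ - xbar‖) := by
  have hμ : 0 ≤ μ := hω.trans hμω
  have hγβ : γ * (β + 2 * μ) < 2 := by rwa [lt_div_iff₀ (by linarith)] at hγ'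
  have hα : 0 < 1 - γ * μ := by linarith [mul_pos hγ hβ]
  have hγμω : γ * ω ≤ γ * μ := mul_le_mul_of_nonneg_left hμω hγ.le
  have hα' : 0 < 1 - γ * ω := by linarith
  have hγω : γ * ω ≤ 1 := by linarith
  -- Equivalent to `γ (β + 2μ) < 2`, the step-size restriction.
  have hκ : 0 < 2 * (1 - γ * μ) / β - γ := by
    rw [sub_pos, lt_div_iff₀ hβ]; linarith
  obtain ⟨z, hz⟩ := hne
  have hsub : ∀ p, p ∈ ForwardBackward.argmin (fun x => (f x : EReal) + g x) ↔
      ForwardBackward.IsHypoSubgradient ω g p (-∇ f p) := fun p => by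
    refine ⟨ForwardBackward.isHypoSubgradient_of_mem_argmin hgp hg (hfd p).hasGradientAt,
      ForwardBackward.mem_argmin_of_isHypoSubgradient hgp fun y => ?_⟩
    have h1 := ForwardBackward.le_of_strongConvexOn hf (hfd p).hasGradientAt y
    have h2 := mul_le_mul_of_nonneg_right hμω (sq_nonneg ‖y - p‖)
    linarith
  -- The minimizer `z` of `f + g` supplies the subgradient that bounds the prox objectives below.
  choose P hP using ForwardBackward.prox_nonempty hgp hgl hg hγ (by linarith) ((hsub z).1 hz)
  have hprox : ∀ x, ForwardBackward.prox γ g x = {P x} := fun x => by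
    refine Set.eq_singleton_iff_unique_mem.2 ⟨hP x, fun q hq => ?_⟩
    have h := ForwardBackward.mul_norm_sq_le_inner_of_mem_prox hgp hg hγ hγω hq (hP x)
    rw [sub_self, inner_zero_left] at h
    have h1 : ‖q - P x‖ ^ 2 ≤ 0 := nonpos_of_mul_nonpos_right h hα'
    exact sub_eq_zero.1 (norm_eq_zero.1
      ((pow_eq_zero_iff two_ne_zero).1 (le_antisymm h1 (sq_nonneg _))))
  set T : X → X := fun x => P (x - γ • ∇ f x) with hT
  have hfix : ∀ p, p ∈ Function.fixedPoints T ↔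
      ForwardBackward.IsHypoSubgradient ω g p (-∇ f p) := fun p => by
    have h1 : p ∈ Function.fixedPoints T ↔ p ∈ ForwardBackward.prox γ g (p - γ • ∇ f p) := by
      rw [hprox, Set.mem_singleton_iff, Function.mem_fixedPoints_iff, eq_comm]
    have e : γ⁻¹ • (p - γ • ∇ f p - p) = -∇ f p := by
      rw [sub_sub_cancel_left, smul_neg, smul_smul, inv_mul_cancel₀ hγ.ne', one_smul]
    rw [h1, ForwardBackward.mem_prox_iff hgp hg hγ hγω, e]
  have hargmin : Function.fixedPoints T =
      ForwardBackward.argmin (fun x => (f x : EReal) + g x) :=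
    Set.ext fun p => (hfix p).trans (hsub p).symm
  have hcoc := ForwardBackward.cocoercive_gradient hμ hβ hf hfd hfL
  have hmono : ∀ x y, (1 - γ * ω) * ‖T x - T y‖ ^ 2 ≤
      ⟪(1 - γ * μ) • (x - y) - γ • ((∇ f x - ∇ f y) - μ • (x - y)), T x - T y⟫ := fun x y => by
    have h := ForwardBackward.mul_norm_sq_le_inner_of_mem_prox hgp hg hγ hγω
      (hP (x - γ • ∇ f x)) (hP (y - γ • ∇ f y))
    have e : (1 - γ * μ) • (x - y) - γ • ((∇ f x - ∇ f y) - μ • (x - y)) =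
        (x - γ • ∇ f x) - (y - γ • ∇ f y) := by module
    rw [e]
    exact h
  have hlip : ∀ x y, ‖T x - T y‖ ≤ (1 - γ * μ) / (1 - γ * ω) * ‖x - y‖ := fun x y =>
    ForwardBackward.norm_backward_le hβ hγ hα hα' hκ (hcoc x y) (hmono x y)
  have hav : ForwardBackward.IsAveraged (2 + 2 * γ / (2 * (1 - γ * μ) / β - γ)) T := fun x y =>
    ForwardBackward.norm_sq_sub_le hβ hγ hα hμω hκ (hcoc x y) (hmono x y)
  have hzfix : T z = z := (hfix z).2 ((hsub z).1 hz)
  refine ⟨P, T, hprox, fun _ => rfl, hargmin, fun S => ?_, fun x₀ => ?_⟩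
  · ext p
    rw [hfix, ← ForwardBackward.mem_subdiff_iff S hgp hgl hg]
    simp [ForwardBackward.zer]
  obtain ⟨w, hw, hlim⟩ := hav.exists_tendsto_weakly (by positivity) hzfix x₀
  refine ⟨w, hw, hlim, fun hlt => ?_⟩
  set δ := (1 - γ * μ) / (1 - γ * ω) with hδ
  have hδ0 : 0 < δ := div_pos hα hα'
  have hδ1 : δ < 1 := by
    rw [hδ, div_lt_one hα']
    linarith [mul_lt_mul_of_pos_left hlt hγ]
  have hsingle : Function.fixedPoints T = {w} := by
    refine Set.eq_singleton_iff_unique_mem.2 ⟨hw, fun q hq => ?_⟩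
    have h := hlip q w
    rw [hw, Function.mem_fixedPoints_iff.1 hq] at h
    have h0 : ‖q - w‖ ≤ 0 := by
      by_contra! hpos
      linarith [mul_lt_mul_of_pos_right hδ1 hpos]
    exact sub_eq_zero.1 (norm_le_zero_iff.1 h0)
  have hstep : ∀ n : ℕ, ‖T^[n + 1] x₀ - w‖ ≤ δ * ‖T^[n] x₀ - w‖ := fun n => by
    have h := hlip (T^[n] x₀) w
    rwa [hw, ← Function.iterate_succ_apply' T] at h
  have hgeom : ∀ n : ℕ, ‖T^[n] x₀ - w‖ ≤ δ ^ n * ‖x₀ - w‖ := fun n => by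
    induction n with
    | zero => simp
    | succ n ih =>
      refine (hstep n).trans ((mul_le_mul_of_nonneg_left ih hδ0.le).trans_eq ?_)
      ring
  refine ⟨hsingle, hargmin ▸ hsingle, hδ0, hδ1, ?_, hstep, hgeom⟩
  rw [tendsto_iff_norm_sub_tendsto_zero]
  refine squeeze_zero (fun n => norm_nonneg _) hgeom ?_
  simpa using (tendsto_pow_atTop_nhds_zero_of_lt_one hδ0.le hδ1).mul_const ‖x₀ - w‖
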